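/- Let $N,t$ be positive integers with $t<N\le 2t$, and let $\eta>0$. Coding schemes. An $N$-node secure multiplication coding scheme $\mathcal C$ consists of the joint distributions of two noise vectors $(\tilde R_1,\dots,\tilde R_N)$ and $(\tilde S_1,\dots,\tilde S_N)$ of real random variables, real scalars $a_i,b_i$ $(1\le i\le N)$, and decoder coefficients $w_0,w_1,\dots,w_N\in\mathbb R$. The two noise vectors are independent of each other and of the pair of real random inputs $(A,B)$. Node $i$ receives $\tilde A_i=a_iA+\tilde R_i$ and $\tilde B_i=b_iB+\tilde S_i$ and outputs $\tilde C_i=\tilde A_i\tilde B_i$; the decoder outputs $\widetilde C=\sum_{i=1}^N w_i\tilde C_i+w_0$. The error of the scheme is $\mathtt{LMSE}(\mathcal C)=\mathbb E\big[|AB-\widetilde C|^2\big]\in[0,\infty]$. Privacy. $\mathcal C$ satisfies $t$-node $\epsilon$-DP if for all $A_0,A_1,B_0,B_1\in\mathbb R$ with $|A_0-A_1|\le1$, $|B_0-B_1|\le 1$, all $T\subseteq\{1,\dots,N\}$ with $|T|=t$ and all Borel sets $\mathcal A\subseteq\mathbb R^{T}$, $$\mathbb P\big((a_iA_0+\tilde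 R_i)_{i\in T}\in\mathcal A\big)\le e^{\epsilon}\,\mathbb P\big((a_iA_1+\tilde R_i)_{i\in T}\in\mathcal A\big)\quad\text{and}\quad \mathbb P\big((b_iB_0+\tilde S_i)_{i\in T}\in\mathcal A\big)\le e^{\epsilon}\,\mathbb P\big((b_iB_1+\tilde S_i)_{i\in T}\in\mathcal A\big).$$ Optimal single-user noise. For $\epsilon>0$ let $\sigma^*(\epsilon)\ge 0$ be given by $$(\sigma^*(\epsilon))^2=\inf_X \mathbb E\big[(X-\mathbb E[X])^2\big],$$ where the infimum is over all real random variables $X$ of finite variance such that $\mathbb P(X+x'\in\mathcal A)\le e^{\epsilon}\,\mathbb P(X+x''\in\mathcal A)$ for all $x',x''\in\mathbb R$ with $|x'-x''|\le1$ and all Borel sets $\mathcal A\subseteq\mathbb R$. Claim. For every $\epsilon,\delta>0$ there exists an $N$-node coding scheme $\mathcal C$ with zero-mean noise variables and a linear decoder ($w_0=0$) that achieves $t$-node $\epsilon$-DP and satisfies $$\mathtt{LMSE}(\mathcal C)\le\frac{\eta^2(\sigma^*(\epsilon))^4}{\big(\eta+(\sigma^*(\epsilon))^2\big)^2}+\delta$$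 for all independent real random variables $A,B$ with $\mathbb E[A^2]\le\eta$ and $\mathbb E[B^2]\le\eta$. -/

import Mathlib

open MeasureTheory ProbabilityTheory

noncomputable section

namespace DPMult

/-- A real-valued noise variable with law `μ` satisfies (single-user, additive) `ε`-DP:
`ℙ(X + x' ∈ s) ≤ e^ε ℙ(X + x'' ∈ s)` for all real `x', x''` at distance at most `1`
and all Borel sets `s`. -/
def NoiseIsDP (ε : ℝ) (μ : Measure ℝ) : Prop :=
  ∀ x' x'' : ℝ, |x' - x''| ≤ 1 → ∀ s : Set ℝ, MeasurableSet s →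
    μ.map (fun x => x + x') s ≤ ENNReal.ofReal (Real.exp ε) * μ.map (fun x => x + x'') s

/-- The variances of the finite-variance noise laws that satisfy single-user `ε`-DP. -/
def dpVariances (ε : ℝ) : Set ℝ :=
  {v | ∃ μ : Measure ℝ, IsProbabilityMeasure μ ∧ NoiseIsDP ε μ ∧ MemLp id 2 μ ∧
    v = variance id μ}

/-- `σ*(ε)`: the smallest noise standard deviation compatible with single-user `ε`-DP, that is,
`σ*(ε)²` is the infimum of the variances. -/
def sigmaStar (ε : ℝ) : ℝ := Real.sqrt (sInf (dpVariances ε))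

/-- An `N`-node secure multiplication coding scheme: the joint law of `(R₁, …, R_N)`, the joint
law of `(S₁, …, S_N)`, the scalars `aᵢ`, `bᵢ`, and the coefficients of the affine decoder. -/
structure CodingScheme (N : ℕ) where
  /-- joint law of the noise `(R₁, …, R_N)` added to the first input -/
  lawR : Measure (Fin N → ℝ)
  /-- joint law of the noise `(S₁, …, S_N)` added to the second input -/
  lawS : Measure (Fin N → ℝ)
  isProbR : IsProbabilityMeasure lawR
  isProbS : IsProbabilityMeasure lawS
  a : Fin N → ℝ
  b : Fin N → ℝ
  w : Fin N → ℝ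
  w₀ : ℝ

namespace CodingScheme

variable {N : ℕ}

/-- The output `Cᵢ = (aᵢ A + Rᵢ)(bᵢ B + Sᵢ)` of node `i`. -/
def nodeOutput (C : CodingScheme N) (A B : ℝ) (R S : Fin N → ℝ) (i : Fin N) : ℝ :=
  (C.a i * A + R i) * (C.b i * B + S i)

/-- The decoder's estimate `∑ᵢ wᵢ Cᵢ + w₀` of the product `A B`. -/
def estimate (C : CodingScheme N) (A B : ℝ) (R S : Fin N → ℝ) : ℝ :=
  ∑ i, C.w i * C.nodeOutput A B R S i + C.w₀

/-- `t`-node `ε`-DP: for every set `T` of `t` nodes, the inputs that the nodes of `T` receive for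
two values of `A` (and likewise of `B`) at distance at most `1` have laws within a factor `e^ε`
of one another on every Borel set. -/
def IsNodeDP (C : CodingScheme N) (t : ℕ) (ε : ℝ) : Prop :=
  ∀ A₀ A₁ B₀ B₁ : ℝ, |A₀ - A₁| ≤ 1 → |B₀ - B₁| ≤ 1 →
    ∀ T : Finset (Fin N), T.card = t → ∀ s : Set (T → ℝ), MeasurableSet s →
      C.lawR.map (fun R (i : T) => C.a i * A₀ + R i) s ≤
          ENNReal.ofReal (Real.exp ε) * C.lawR.map (fun R (i : T) => C.a i * A₁ + R i) s ∧
      C.lawS.map (fun S (i : T) => C.b i * B₀ + S i) s ≤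
          ENNReal.ofReal (Real.exp ε) * C.lawS.map (fun S (i : T) => C.b i * B₁ + S i) s

/-- All noise variables have mean zero and the decoder is linear. -/
def IsCentered (C : CodingScheme N) : Prop :=
  (∀ i, Integrable (fun R => R i) C.lawR ∧ ∫ R, R i ∂C.lawR = 0) ∧
  (∀ i, Integrable (fun S => S i) C.lawS ∧ ∫ S, S i ∂C.lawS = 0) ∧
  C.w₀ = 0

/-- The mean square error `𝔼 |AB - C̃|²` (with value `∞` when the expectation does not exist) for
inputs `(A, B)` of joint law `P`; `(A, B)`, `(Rᵢ)ᵢ` and `(Sᵢ)ᵢ` are independent. -/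
def LMSE (C : CodingScheme N) (P : Measure (ℝ × ℝ)) : ENNReal :=
  ∫⁻ ω : (ℝ × ℝ) × ((Fin N → ℝ) × (Fin N → ℝ)),
    ENNReal.ofReal (|ω.1.1 * ω.1.2 - C.estimate ω.1.1 ω.1.2 ω.2.1 ω.2.2| ^ 2)
    ∂(P.prod (C.lawR.prod C.lawS))

end CodingScheme

/-- `P` is the joint law of independent real random variables `A`, `B` with `𝔼[A²] ≤ η` and
`𝔼[B²] ≤ η`. -/
structure IsInputLaw (η : ℝ) (P : Measure (ℝ × ℝ)) : Prop where
  isProb : IsProbabilityMeasure P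
  indep : IndepFun Prod.fst Prod.snd P
  memLp_fst : MemLp Prod.fst 2 P
  memLp_snd : MemLp Prod.snd 2 P
  fst_le : ∫ p, p.1 ^ 2 ∂P ≤ η
  snd_le : ∫ p, p.2 ^ 2 ∂P ≤ η

end DPMult

end

/-! Write `N = n + 1`, so a coalition of `t` nodes misses at least one node. Give node `0` the input
`A + (1 + ξ) R` and the others `A + R + ζ Wᵢ`, where the `Wᵢ` are built from a second noise vector
`V` and sum to zero; treat `B` likewise with `S`.

Accuracy: averaging the outputs of the nodes other than `0` gives `(A + R)(B + S)` up to order `ζ²`,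
the terms linear in `Wᵢ` cancelling. Subtracting this from node `0` and dividing by `ξ` gives `(A +
R)(B + S) - AB + RS` up to order `ξ` and `ζ² / ξ`. Combining the two makes the error nearly `(A - c
(A + R)) (B - c (B + S))`. By independence its mean square is the product of two linear estimation
errors, at most `(η s / (η + s))²` for noise variance `s` and `c = η / (η + s)`.

Privacy: without node `0`, a change of input is a shift of `R`; without another node, it is a
smaller shift of `R` and a shift of one `Vₖ`, small because `ξ ≤ ζ`. The privacy levels of `R` and
`V` add, so `R` must be strictly better than `ε`-private; `NoiseIsDP.exists_lt_isTranslationDP`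
provides this at negligible cost in variance. Taking `ξ = x³`, `ζ = x²` satisfies `ξ ≤ ζ` while `ζ²
/ ξ = x` tends to zero. -/

namespace DPMult

/-! ### Translation-private laws: centring and convolution -/

/-- Translating the law `μ` by a vector of norm at most `1` changes it by a factor of at most
`e^ε`. -/
def IsTranslationDP {E : Type*} [NormedAddCommGroup E] [MeasurableSpace E] (ε : ℝ)
    (μ : Measure E) : Prop :=
  ∀ v : E, ‖v‖ ≤ 1 → μ.map (fun x => x + v) ≤ ENNReal.ofReal (Real.exp ε) • μ

theorem NoiseIsDP.isTranslationDP {ε : ℝ} {μ : Measure ℝ} (h : NoiseIsDP ε μ) :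
    IsTranslationDP ε μ := by
  intro v hv
  refine Measure.le_iff.2 fun s hs => ?_
  simpa using h v 0 (by simpa using hv) s hs

theorem IsTranslationDP.noiseIsDP {ε : ℝ} {μ : Measure ℝ} (h : IsTranslationDP ε μ) :
    NoiseIsDP ε μ := by
  intro x' x'' hx s hs
  have h1 := Measure.map_mono (h (x' - x'') hx) (measurable_id.add_const x'')
  have h2 := h1 s
  rw [Measure.map_map (by fun_prop) (by fun_prop), Measure.map_smul] at h2
  have h3 : ((fun x : ℝ => id x + x'') ∘ fun x => x + (x' - x'')) = fun x => x + x' := by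
    funext x; simp only [Function.comp, id]; ring
  simpa [h3] using h2

theorem IsTranslationDP.smul {E : Type*} [NormedAddCommGroup E] [MeasurableSpace E] {ε : ℝ}
    {μ : Measure E} (h : IsTranslationDP ε μ) (c : ENNReal) : IsTranslationDP ε (c • μ) := by
  intro v hv
  rw [Measure.map_smul, smul_comm]
  refine Measure.le_iff.2 fun s _ => ?_
  simpa using mul_le_mul_right (h v hv s) c

section

variable {E : Type*} [NormedAddCommGroup E] [MeasurableSpace E] [BorelSpace E]

theorem IsTranslationDP.map_add_right {ε : ℝ} {μ : Measure E} (h : IsTranslationDP ε μ) (m : E) :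
    IsTranslationDP ε (μ.map (fun x => x + m)) := by
  intro v hv
  have h1 := Measure.map_mono (h v hv) (measurable_id.add_const m)
  rw [Measure.map_map (by fun_prop) (by fun_prop), Measure.map_smul] at h1
  rw [Measure.map_map (by fun_prop) (by fun_prop)]
  have h3 : ((fun x : E => id x + m) ∘ fun x => x + v) =
      (fun x => x + v) ∘ fun x => x + m := by
    funext x; simp [add_right_comm]
  rw [← h3]
  exact h1

/-- Translating an independent sum amounts to translating the private summand alone. -/
theorem IsTranslationDP.conv_left [SecondCountableTopology E] {ε : ℝ} {μ : Measure E}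
    (h : IsTranslationDP ε μ) (ν : Measure E) [SFinite μ] [SFinite ν] : IsTranslationDP ε (ν.conv μ) := by
  intro v hv
  have h1 : (ν.conv μ).map (fun x => x + v) = ν.conv (μ.map (fun x => x + v)) := by
    have h2 : ν.prod (μ.map (fun x => x + v)) =
        (ν.prod μ).map (Prod.map id (fun x => x + v)) := by
      rw [← Measure.map_prod_map _ _ measurable_id (by fun_prop), Measure.map_id]
    rw [Measure.conv, Measure.conv, h2, Measure.map_map (by fun_prop) (by fun_prop),
      Measure.map_map (by fun_prop) (by fun_prop)]
    congr 1
    funext x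
    simp [add_assoc]
  rw [h1, Measure.conv, Measure.conv, ← Measure.map_smul, ← Measure.prod_smul_right]
  exact Measure.map_mono (Measure.prod_mono le_rfl (h v hv)) (by fun_prop)

/-- An integrable translation-DP law can be centred. -/
theorem exists_centered_translationDP [SecondCountableTopology E] [NormedSpace ℝ E] [CompleteSpace E]
    {ε : ℝ} {μ : Measure E} [IsProbabilityMeasure μ] (h : IsTranslationDP ε μ) (h2 : MemLp id 2 μ) :
    ∃ m : E, IsProbabilityMeasure (μ.map (fun x => x + m)) ∧
      IsTranslationDP ε (μ.map (fun x => x + m)) ∧ MemLp id 2 (μ.map (fun x => x + m)) ∧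
      ∫ x, x ∂(μ.map (fun x => x + m)) = 0 := by
  refine ⟨- ∫ x, x ∂μ, Measure.isProbabilityMeasure_map (by fun_prop), h.map_add_right _, ?_, ?_⟩
  · rw [memLp_map_measure_iff (by fun_prop) (by fun_prop)]
    exact h2.add (memLp_const _)
  · rw [integral_map (by fun_prop) (by fun_prop)]
    have h3 : Integrable (fun x : E => x) μ := h2.integrable (by norm_num)
    rw [integral_add h3 (integrable_const _)]
    simp

end

/-! ### Exponential noise on a finite-dimensional space -/

section

variable {E : Type*} [NormedAddCommGroup E] [NormedSpace ℝ E] [FiniteDimensional ℝ E]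
  [MeasureSpace E] [BorelSpace E] [(volume : Measure E).IsAddHaarMeasure]

theorem integrable_sq_mul_exp_neg_norm {ε : ℝ} (hε : 0 < ε) :
    Integrable (fun x : E => (1 + ‖x‖) ^ 2 * Real.exp (-(ε * ‖x‖))) volume := by
  set r := Module.finrank ℝ E + 1 with hr
  have h1 : Integrable (fun x : E => (1 + ‖x‖) ^ (-(r : ℝ))) volume :=
    integrable_one_add_norm (by rw [hr]; push_cast; linarith)
  -- The constant comes from `y ^ k / k! ≤ exp y` at `y = ε (1 + ‖x‖)`, `k = r + 2`: two powers
  -- absorb the square and `r` give integrable decay.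
  refine (h1.const_mul ((r + 2).factorial * Real.exp ε / ε ^ (r + 2))).mono'
    (by fun_prop) (Filter.Eventually.of_forall fun x => ?_)
  have hy : 0 < 1 + ‖x‖ := by positivity
  rw [Real.norm_of_nonneg (by positivity), Real.rpow_neg hy.le, Real.rpow_natCast]
  have h2 := Real.pow_div_factorial_le_exp (ε * (1 + ‖x‖)) (by positivity) (r + 2)
  have h3 : Real.exp (ε * (1 + ‖x‖)) = Real.exp ε * Real.exp (ε * ‖x‖) := by
    rw [← Real.exp_add]; ring_nf
  rw [h3, div_le_iff₀ (by positivity), mul_pow] at h2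
  rw [Real.exp_neg, ← div_eq_mul_inv, ← div_eq_mul_inv, div_div,
    div_le_div_iff₀ (by positivity) (by positivity)]
  calc (1 + ‖x‖) ^ 2 * (ε ^ (r + 2) * (1 + ‖x‖) ^ r)
      = ε ^ (r + 2) * (1 + ‖x‖) ^ (r + 2) := by ring
    _ ≤ _ := h2
    _ = _ := by ring

/-- There is a law with full support and finite second moment that is translation-DP. -/
theorem exists_translationDP {ε : ℝ} (hε : 0 < ε) :
    ∃ κ : Measure E, IsProbabilityMeasure κ ∧ IsTranslationDP ε κ ∧ MemLp id 2 κ ∧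
      (volume : Measure E) ≪ κ := by
  set h : E → ℝ := fun x => Real.exp (-(ε * ‖x‖)) with hh
  have hcont : Continuous h := by fun_prop
  have hm : Measurable fun x => ENNReal.ofReal (h x) := by fun_prop
  set ν : Measure E := volume.withDensity (fun x => ENNReal.ofReal (h x)) with hν
  have hi2 := integrable_sq_mul_exp_neg_norm (E := E) hε
  have hint : Integrable h volume := by
    refine hi2.mono' (by fun_prop) (Filter.Eventually.of_forall fun x => ?_)
    rw [Real.norm_of_nonneg (by positivity)]
    have : (1 : ℝ) ≤ (1 + ‖x‖) ^ 2 := one_le_pow₀ (by simp)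
    exact le_mul_of_one_le_left (by positivity) this
  have hfin : IsFiniteMeasure ν := isFiniteMeasure_withDensity_ofReal hint.2
  have hac : (volume : Measure E) ≪ ν :=
    withDensity_absolutelyContinuous' hm.aemeasurable
      (Filter.Eventually.of_forall fun x => by simp [hh, Real.exp_pos])
  have hne : ν ≠ 0 := by
    intro h0
    rw [h0] at hac
    exact (NeZero.ne (volume : Measure E)) (Measure.absolutelyContinuous_zero_iff.1 hac)
  have hν0 : NeZero ν := ⟨hne⟩
  -- By invariance of Haar measure this reduces to `h x ≤ exp ε * h (x + v)`, the triangle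
  -- inequality.
  have hDP : IsTranslationDP ε ν := by
    intro v hv
    refine Measure.le_iff.2 fun s hs => ?_
    have hs' : MeasurableSet ((fun x => x + v) ⁻¹' s) := (measurable_add_const v) hs
    rw [Measure.map_apply (by fun_prop) hs, Measure.smul_apply, hν, withDensity_apply _ hs',
      withDensity_apply _ hs, smul_eq_mul, ← lintegral_const_mul _ hm,
      ← lintegral_indicator hs', ← lintegral_indicator hs,
      ← lintegral_add_right_eq_self (s.indicator _) v]
    refine lintegral_mono fun x => ?_
    by_cases hx : x + v ∈ s
    · rw [Set.indicator_of_mem (show x ∈ (fun x => x + v) ⁻¹' s from hx), Set.indicator_of_mem hx,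
        ← ENNReal.ofReal_mul (Real.exp_pos _).le]
      refine ENNReal.ofReal_le_ofReal ?_
      simp only [hh]
      rw [← Real.exp_add]
      refine Real.exp_le_exp.2 ?_
      have h5 : ‖x + v‖ ≤ ‖x‖ + 1 := (norm_add_le x v).trans (by linarith)
      nlinarith
    · rw [Set.indicator_of_notMem (show x ∉ (fun x => x + v) ⁻¹' s from hx)]
      exact zero_le
  have hL2 : MemLp id 2 ν := by
    rw [memLp_two_iff_integrable_sq_norm (by fun_prop), hν,
      integrable_withDensity_iff hm (by simp)]
    refine hi2.mono' (by fun_prop) (Filter.Eventually.of_forall fun x => ?_)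
    rw [ENNReal.toReal_ofReal (by positivity), Real.norm_of_nonneg (by positivity)]
    simp only [id]
    gcongr
    linarith
  have hu : ν Set.univ ≠ 0 := by simpa using hne
  refine ⟨(ν Set.univ)⁻¹ • ν, inferInstance, hDP.smul _, hL2.smul_measure (by simpa using hne), ?_⟩
  exact hac.trans (Measure.absolutelyContinuous_smul (by simp))

end

/-! ### Left-continuity of the optimal variance in the privacy level -/

/-- A noise law satisfying `ε`-DP is dominated by a multiple of its convolution with any law that
charges the unit ball. -/
theorem NoiseIsDP.le_smul_conv {ε : ℝ} {μ : Measure ℝ} [IsProbabilityMeasure μ]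
    (h : NoiseIsDP ε μ) (ν : Measure ℝ) [IsProbabilityMeasure ν]
    (hν : ν (Metric.closedBall 0 1) ≠ 0) :
    ∃ K : ℝ, 0 < K ∧ μ ≤ ENNReal.ofReal K • μ.conv ν := by
  set p := (ν (Metric.closedBall 0 1)).toReal with hp
  have hp0 : 0 < p := ENNReal.toReal_pos hν (measure_ne_top _ _)
  have hpe : ν (Metric.closedBall 0 1) = ENNReal.ofReal p :=
    (ENNReal.ofReal_toReal (measure_ne_top _ _)).symm
  refine ⟨Real.exp ε / p, by positivity, Measure.le_iff.2 fun s hs => ?_⟩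
  have hadd : Measurable fun x : ℝ × ℝ => x.1 + x.2 := by fun_prop
  have hg : (μ.conv ν) s = ∫⁻ y, μ.map (fun x => x + y) s ∂ν := by
    rw [Measure.conv, Measure.map_apply hadd hs, Measure.prod_apply_symm (hadd hs)]
    refine lintegral_congr fun y => ?_
    rw [Measure.map_apply (by fun_prop) hs]
    rfl
  -- Integrate the privacy inequality between `μ` and its translate by `y` over `y` in the unit
  -- ball.
  have key : μ s * ENNReal.ofReal p ≤ ENNReal.ofReal (Real.exp ε) * (μ.conv ν) s := by
    rw [hg, ← hpe, ← setLIntegral_const, ← lintegral_const_mul' _ _ ENNReal.ofReal_ne_top]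
    refine (setLIntegral_mono' Metric.isClosed_closedBall.measurableSet fun y hy => ?_).trans
      (setLIntegral_le_lintegral _ _)
    have hy' : |0 - y| ≤ 1 := by simpa using hy
    simpa using h 0 y hy' s hs
  rw [Measure.smul_apply, smul_eq_mul, ENNReal.ofReal_div_of_pos hp0, ENNReal.mul_comm_div,
    ← mul_div_assoc, ENNReal.le_div_iff_mul_le (Or.inl (by simpa using hp0))
    (Or.inl ENNReal.ofReal_ne_top)]
  exact key

/-- Mixing in a law with a better privacy level improves the privacy level. -/
theorem exists_lt_isTranslationDP_mixture {ε : ℝ} (hε : 0 < ε) {μ g : Measure ℝ}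
    [IsProbabilityMeasure μ] [IsProbabilityMeasure g] (hμ : IsTranslationDP ε μ)
    (hg : IsTranslationDP (ε / 2) g) {K : ℝ} (hK : 0 < K) (hle : μ ≤ ENNReal.ofReal K • g)
    {l : ℝ} (hl0 : 0 < l) (hl1 : l < 1) :
    ∃ ε' < ε, IsTranslationDP ε' (ENNReal.ofReal (1 - l) • μ + ENNReal.ofReal l • g) := by
  -- Level `x` for the mixture follows once this expression is nonnegative, using `μ ≤ K g`. At `x =
  -- ε` it is strictly positive, hence also for some `x < ε`.
  have hcont : Continuous fun x : ℝ =>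
      l * (Real.exp x - Real.exp (ε / 2)) - (1 - l) * (Real.exp ε - Real.exp x) * K := by
    fun_prop
  have hpos : 0 < l * (Real.exp ε - Real.exp (ε / 2)) -
      (1 - l) * (Real.exp ε - Real.exp ε) * K := by
    have : Real.exp (ε / 2) < Real.exp ε := Real.exp_lt_exp.2 (by linarith)
    nlinarith [mul_pos hl0 (sub_pos.2 this)]
  have hev := (hcont.tendsto ε).eventually (lt_mem_nhds hpos)
  obtain ⟨x, hx, hxε⟩ := ((hev.filter_mono nhdsWithin_le_nhds).and
    (self_mem_nhdsWithin (a := ε) (s := Set.Iio ε))).exists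
  refine ⟨x, hxε, fun v hv => Measure.le_iff.2 fun s hs => ?_⟩
  have h1 := hμ v hv s
  have h2 := hg v hv s
  have h3 := hle s
  have : IsProbabilityMeasure (μ.map fun x => x + v) :=
    Measure.isProbabilityMeasure_map (by fun_prop)
  have : IsProbabilityMeasure (g.map fun x => x + v) :=
    Measure.isProbabilityMeasure_map (by fun_prop)
  rw [Measure.map_add _ _ (by fun_prop), Measure.map_smul, Measure.map_smul]
  simp only [Measure.smul_apply, Measure.add_apply, smul_eq_mul] at h1 h2 h3 ⊢
  rw [← ofReal_measureReal (μ := μ), ← ofReal_measureReal (μ := μ.map _),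
    ← ENNReal.ofReal_mul (Real.exp_pos _).le,
    ENNReal.ofReal_le_ofReal_iff (by positivity)] at h1
  rw [← ofReal_measureReal (μ := g), ← ofReal_measureReal (μ := g.map _),
    ← ENNReal.ofReal_mul (Real.exp_pos _).le,
    ENNReal.ofReal_le_ofReal_iff (by positivity)] at h2
  rw [← ofReal_measureReal (μ := g), ← ofReal_measureReal (μ := μ),
    ← ENNReal.ofReal_mul hK.le, ENNReal.ofReal_le_ofReal_iff (by positivity)] at h3
  have hl : 0 < 1 - l := by linarith
  rw [← ofReal_measureReal (μ := g), ← ofReal_measureReal (μ := μ),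
    ← ofReal_measureReal (μ := μ.map _), ← ofReal_measureReal (μ := g.map _),
    ← ENNReal.ofReal_mul hl.le, ← ENNReal.ofReal_mul hl.le, ← ENNReal.ofReal_mul hl0.le,
    ← ENNReal.ofReal_mul hl0.le, ← ENNReal.ofReal_add (by positivity) (by positivity),
    ← ENNReal.ofReal_add (by positivity) (by positivity), ← ENNReal.ofReal_mul (by positivity)]
  refine ENNReal.ofReal_le_ofReal ?_
  have hg0 : 0 ≤ g.real s := measureReal_nonneg
  have hex : 0 ≤ Real.exp ε - Real.exp x := sub_nonneg.2 (Real.exp_le_exp.2 (le_of_lt hxε))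
  have e1 := mul_le_mul_of_nonneg_left h1 hl.le
  have e2 := mul_le_mul_of_nonneg_left h2 hl0.le
  have e3 := mul_le_mul_of_nonneg_left h3 (mul_nonneg hl.le hex)
  have e4 := mul_nonneg hx.le hg0
  nlinarith

/-- The optimal variance is left-continuous in the privacy level: up to an arbitrarily small loss
of variance, the privacy level may be taken strictly smaller. -/
theorem NoiseIsDP.exists_lt_isTranslationDP {ε : ℝ} (hε : 0 < ε) {μ : Measure ℝ}
    [IsProbabilityMeasure μ] (h : NoiseIsDP ε μ) (h2 : MemLp id 2 μ) {δ : ℝ} (hδ : 0 < δ) :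
    ∃ ε' < ε, ∃ ρ : Measure ℝ, IsProbabilityMeasure ρ ∧ IsTranslationDP ε' ρ ∧ MemLp id 2 ρ ∧
      ∫ x, x ∂ρ = 0 ∧ ∫ x, x ^ 2 ∂ρ ≤ variance id μ + δ := by
  obtain ⟨ν, hν, hνDP, hν2, hνac⟩ := exists_translationDP (E := ℝ) (half_pos hε)
  obtain ⟨K, hK, hle⟩ := h.le_smul_conv ν
    (fun h0 => (Metric.measure_closedBall_pos volume (0 : ℝ) one_pos).ne' (hνac h0))
  have hg2 : MemLp id 2 (μ.conv ν) := by
    rw [Measure.conv, memLp_map_measure_iff (by fun_prop) (by fun_prop)]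
    exact (h2.comp_fst ν).add (hν2.comp_snd μ)
  set g := μ.conv ν with hg
  set m := ∫ x, x ∂μ with hm
  -- The moment of `g` is taken about the mean of `μ`, so that moments about `m` average in the
  -- mixture; the weight `l` is chosen to make `l * q ≤ δ`.
  set q := ∫ x, (x - m) ^ 2 ∂g with hq
  have hq0 : 0 ≤ q := integral_nonneg fun x => sq_nonneg _
  have hl0 : 0 < δ / (q + δ + 1) := by positivity
  have hl1 : δ / (q + δ + 1) < 1 := by rw [div_lt_one (by positivity)]; linarith
  have hlq : δ / (q + δ + 1) * q ≤ δ := by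
    rw [div_mul_eq_mul_div, div_le_iff₀ (by positivity)]
    nlinarith
  set l := δ / (q + δ + 1) with hl
  obtain ⟨ε', hε', hDP⟩ := exists_lt_isTranslationDP_mixture hε h.isTranslationDP
    (hνDP.conv_left μ) hK hle hl0 hl1
  set ρ := ENNReal.ofReal (1 - l) • μ + ENNReal.ofReal l • g with hρ
  have hρp : IsProbabilityMeasure ρ := by
    constructor
    simp only [hρ, Measure.add_apply, Measure.smul_apply, measure_univ, smul_eq_mul, mul_one]
    rw [← ENNReal.ofReal_add (by linarith) hl0.le]
    simp
  have hμi : Integrable (fun x => (x - m) ^ 2) μ := (h2.sub (memLp_const m)).integrable_sq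
  have hgi : Integrable (fun x => (x - m) ^ 2) g := (hg2.sub (memLp_const m)).integrable_sq
  have hρ2 : MemLp id 2 ρ := by
    have h3 := (memLp_two_iff_integrable_sq (by fun_prop)).1 h2
    have h4 := (memLp_two_iff_integrable_sq (by fun_prop)).1 hg2
    rw [memLp_two_iff_integrable_sq (by fun_prop)]
    exact (h3.smul_measure ENNReal.ofReal_ne_top).add_measure
      (h4.smul_measure ENNReal.ofReal_ne_top)
  have hsq : ∫ x, (x - m) ^ 2 ∂ρ = (1 - l) * variance id μ + l * q := by
    rw [hρ, integral_add_measure (hμi.smul_measure ENNReal.ofReal_ne_top)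
      (hgi.smul_measure ENNReal.ofReal_ne_top), integral_smul_measure, integral_smul_measure,
      ENNReal.toReal_ofReal (by linarith), ENNReal.toReal_ofReal hl0.le,
      variance_eq_integral (by fun_prop)]
    rfl
  obtain ⟨c, hp, hcDP, hc2, hc0⟩ := exists_centered_translationDP hDP hρ2
  refine ⟨ε', hε', _, hp, hcDP, hc2, hc0, ?_⟩
  have hv : ∫ x, x ^ 2 ∂(ρ.map fun x => x + c) = variance id (ρ.map fun x => x + c) :=
    (variance_of_integral_eq_zero (by fun_prop) hc0).symm
  have hv2 : variance id (ρ.map fun x => x + c) = variance (fun x => x - m) ρ := by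
    rw [variance_id_map (by fun_prop), variance_add_const (by fun_prop),
      variance_sub_const (by fun_prop)]
  have hv3 : variance (fun x => x - m) ρ ≤ ∫ x, (x - m) ^ 2 ∂ρ :=
    variance_le_expectation_sq (by fun_prop)
  have hvn : 0 ≤ variance id μ := variance_nonneg _ _
  rw [hv, hv2]
  refine hv3.trans ?_
  rw [hsq]
  nlinarith

/-- Centred noise with variance arbitrarily close to optimal and privacy level better than `ε`. -/
theorem exists_noise_near_sigmaStar {ε : ℝ} (hε : 0 < ε) {δ : ℝ} (hδ : 0 < δ) :
    ∃ ε' < ε, ∃ ρ : Measure ℝ, IsProbabilityMeasure ρ ∧ IsTranslationDP ε' ρ ∧ MemLp id 2 ρ ∧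
      ∫ x, x ∂ρ = 0 ∧ ∫ x, x ^ 2 ∂ρ < sigmaStar ε ^ 2 + δ := by
  obtain ⟨ν, hν, hνDP, hν2, -⟩ := exists_translationDP (E := ℝ) hε
  have hne : (dpVariances ε).Nonempty := ⟨_, ν, hν, hνDP.noiseIsDP, hν2, rfl⟩
  have h0 : 0 ≤ sInf (dpVariances ε) := by
    refine Real.sInf_nonneg ?_
    rintro v ⟨μ, -, -, -, rfl⟩
    exact variance_nonneg _ _
  have hs : sigmaStar ε ^ 2 = sInf (dpVariances ε) := Real.sq_sqrt h0
  obtain ⟨v, ⟨μ, hμ, hμDP, hμ2, rfl⟩, hv⟩ := exists_lt_of_csInf_lt hne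
    (show sInf (dpVariances ε) < sInf (dpVariances ε) + δ / 2 by linarith)
  obtain ⟨ε', hε', ρ, hρ, hρDP, hρ2, hρ0, hle⟩ :=
    hμDP.exists_lt_isTranslationDP hε hμ2 (half_pos hδ)
  exact ⟨ε', hε', ρ, hρ, hρDP, hρ2, hρ0, by rw [hs]; linarith⟩

/-! ### Layered noise and its privacy -/

/-- The layered noise: node `0` gets `(1 + ξ) R`, and node `i + 1` gets `R + ζ (n Vᵢ - ∑ⱼ Vⱼ)`,
so that the perturbations of the nodes other than `0` sum to zero. -/
def layeredNoise (n : ℕ) (ξ ζ : ℝ) (p : ℝ × (Fin n → ℝ)) : Fin (n + 1) → ℝ :=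
  Fin.cons ((1 + ξ) * p.1) fun i => p.1 + ζ * (n * p.2 i - ∑ j, p.2 j)

@[simp] theorem layeredNoise_zero (n : ℕ) (ξ ζ : ℝ) (p : ℝ × (Fin n → ℝ)) :
    layeredNoise n ξ ζ p 0 = (1 + ξ) * p.1 := rfl

@[simp] theorem layeredNoise_succ (n : ℕ) (ξ ζ : ℝ) (p : ℝ × (Fin n → ℝ)) (i : Fin n) :
    layeredNoise n ξ ζ p i.succ = p.1 + ζ * (n * p.2 i - ∑ j, p.2 j) := rfl

@[fun_prop]
theorem measurable_layeredNoise (n : ℕ) (ξ ζ : ℝ) : Measurable (layeredNoise n ξ ζ) := by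
  refine measurable_pi_lambda _ fun i => ?_
  refine Fin.cases ?_ (fun i => ?_) i
  · simp only [layeredNoise_zero]; fun_prop
  · simp only [layeredNoise_succ]; fun_prop

/-- For every node `j`, a shift of the input by `d` is seen by the nodes other than `j` as a shift
of the underlying noise. -/
theorem exists_shift_layeredNoise {n : ℕ} {ξ ζ : ℝ} (hξ : 0 < ξ) (hζ : 0 < ζ)
    (hξζ : ξ ≤ ζ) (j : Fin (n + 1)) {d : ℝ} (hd : |d| ≤ 1) :
    ∃ (u : ℝ) (v : Fin n → ℝ), ‖u‖ ≤ 1 ∧ ‖v‖ ≤ 1 ∧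
      ∀ p : ℝ × (Fin n → ℝ), ∀ i ≠ j,
        layeredNoise n ξ ζ (p.1 + u, p.2 + v) i = layeredNoise n ξ ζ p i + d := by
  rcases Fin.eq_zero_or_eq_succ j with rfl | ⟨k, rfl⟩
  · refine ⟨d, 0, by simpa using hd, by simp, fun p i hi => ?_⟩
    obtain ⟨i, rfl⟩ := Fin.exists_succ_eq_of_ne_zero hi
    simp only [layeredNoise_succ, add_zero]
    ring
  · have h1 : 0 < 1 + ξ := by linarith
    -- Node `0` forces the shift of `R`. The other visible nodes then lack `d ξ / (1 + ξ)`, which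
    -- they receive from `Vₖ` through `-ζ ∑ⱼ Vⱼ`.
    refine ⟨d / (1 + ξ), Pi.single k (-(d * ξ / (ζ * (1 + ξ)))), ?_, ?_, fun p i hi => ?_⟩
    · rw [Real.norm_eq_abs, abs_div, abs_of_pos h1, div_le_one h1]
      linarith
    · rw [Pi.norm_single, Real.norm_eq_abs, abs_neg, abs_div, abs_mul, abs_of_pos hξ,
        abs_of_pos (mul_pos hζ h1), div_le_one (by positivity)]
      nlinarith [abs_nonneg d]
    · refine Fin.cases (fun _ => ?_) (fun i hi => ?_) i hi
      · simp only [layeredNoise_zero]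
        field_simp
      · have hik : i ≠ k := fun h => hi (by rw [h])
        simp only [layeredNoise_succ, Pi.add_apply, Pi.single_eq_of_ne hik,
          Finset.sum_add_distrib, Finset.sum_pi_single', Finset.mem_univ, if_true]
        field_simp
        ring

/-- Coalitions of at most `n` of the `n + 1` nodes learn little from layered noise. -/
theorem layeredNoise_map_le {n : ℕ} {ξ ζ : ℝ} (hξ : 0 < ξ) (hζ : 0 < ζ) (hξζ : ξ ≤ ζ)
    {ε₁ ε₂ : ℝ} {ρ : Measure ℝ} {κ : Measure (Fin n → ℝ)} [IsProbabilityMeasure ρ]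
    [IsProbabilityMeasure κ] (hρ : IsTranslationDP ε₁ ρ) (hκ : IsTranslationDP ε₂ κ)
    {x y : ℝ} (hxy : |x - y| ≤ 1) (T : Finset (Fin (n + 1))) (hT : T.card ≤ n)
    (s : Set (T → ℝ)) :
    ((ρ.prod κ).map (layeredNoise n ξ ζ)).map (fun R (i : T) => 1 * x + R i) s ≤
      ENNReal.ofReal (Real.exp (ε₁ + ε₂)) *
        ((ρ.prod κ).map (layeredNoise n ξ ζ)).map (fun R (i : T) => 1 * y + R i) s := by
  obtain ⟨j, hj⟩ : ∃ j, j ∉ T := by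
    by_contra! h
    have h2 := Finset.card_le_card (show Finset.univ ⊆ T from fun i _ => h i)
    simp at h2
    omega
  obtain ⟨u, v, hu, hv, huv⟩ := exists_shift_layeredNoise hξ hζ hξζ j hxy
  have hmeas : ∀ z : ℝ, Measurable fun (R : Fin (n + 1) → ℝ) (i : T) => 1 * z + R i := by
    intro z; fun_prop
  rw [Measure.map_map (hmeas x) (by fun_prop), Measure.map_map (hmeas y) (by fun_prop)]
  have hprod : (ρ.prod κ).map (Prod.map (fun r => r + u) fun w => w + v) ≤
      ENNReal.ofReal (Real.exp (ε₁ + ε₂)) • ρ.prod κ := by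
    rw [← Measure.map_prod_map _ _ (by fun_prop) (by fun_prop), Real.exp_add,
      ENNReal.ofReal_mul (Real.exp_pos _).le, mul_smul, ← Measure.prod_smul_right,
      ← Measure.prod_smul_left]
    exact Measure.prod_mono (hρ u hu) (hκ v hv)
  have hm := Measure.map_mono hprod ((hmeas y).comp (measurable_layeredNoise n ξ ζ)) s
  rw [Measure.map_map (by fun_prop) (by fun_prop), Measure.map_smul] at hm
  have heq : ((fun (R : Fin (n + 1) → ℝ) (i : T) => 1 * y + R i) ∘ layeredNoise n ξ ζ) ∘
      (Prod.map (fun r => r + u) fun w => w + v) =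
      (fun (R : Fin (n + 1) → ℝ) (i : T) => 1 * x + R i) ∘ layeredNoise n ξ ζ := by
    funext p i
    have := huv p i (fun h => hj (h ▸ i.2))
    simp only [Function.comp, Prod.map]
    rw [this]
    ring
  rw [heq] at hm
  exact hm

theorem integrable_layeredNoise {n : ℕ} (ξ ζ : ℝ) {ρ : Measure ℝ} {κ : Measure (Fin n → ℝ)}
    [IsProbabilityMeasure ρ] [IsProbabilityMeasure κ] (hρ : Integrable id ρ)
    (hκ : Integrable id κ) (hρ0 : ∫ x, x ∂ρ = 0) (hκ0 : ∫ x, x ∂κ = 0) (i : Fin (n + 1)) :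
    Integrable (fun R => R i) ((ρ.prod κ).map (layeredNoise n ξ ζ)) ∧
      ∫ R, R i ∂((ρ.prod κ).map (layeredNoise n ξ ζ)) = 0 := by
  have hκi : ∀ i, Integrable (fun x : Fin n → ℝ => x i) κ := fun i => hκ.eval i
  have hκi0 : ∀ i, ∫ x, x i ∂κ = 0 := by
    intro i
    rw [← eval_integral hκi, hκ0, Pi.zero_apply]
  have h1 : Integrable (fun p : ℝ × (Fin n → ℝ) => p.1) (ρ.prod κ) := hρ.comp_fst κ
  have h2 : ∀ i, Integrable (fun p : ℝ × (Fin n → ℝ) => p.2 i) (ρ.prod κ) :=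
    fun i => (hκi i).comp_snd ρ
  have h10 : ∫ p : ℝ × (Fin n → ℝ), p.1 ∂(ρ.prod κ) = 0 := by
    rw [integral_fun_fst (fun x : ℝ => x), hρ0, smul_zero]
  have h20 : ∀ i, ∫ p : ℝ × (Fin n → ℝ), p.2 i ∂(ρ.prod κ) = 0 := by
    intro i
    rw [integral_fun_snd (fun x : Fin n → ℝ => x i), hκi0, smul_zero]
  have hi : Measurable fun R : Fin (n + 1) → ℝ => R i := measurable_pi_apply i
  rw [integrable_map_measure hi.aestronglyMeasurable (by fun_prop),
    integral_map (by fun_prop) hi.aestronglyMeasurable]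
  refine Fin.cases ?_ (fun i => ?_) i
  · refine ⟨h1.const_mul _, ?_⟩
    simp only [layeredNoise_zero]
    rw [integral_const_mul, h10, mul_zero]
  · have h3 : Integrable (fun p : ℝ × (Fin n → ℝ) => (n : ℝ) * p.2 i) (ρ.prod κ) :=
      (h2 i).const_mul _
    have h4 : Integrable (fun p : ℝ × (Fin n → ℝ) => ∑ j, p.2 j) (ρ.prod κ) :=
      integrable_finsetSum _ fun j _ => h2 j
    refine ⟨h1.add ((h3.sub h4).const_mul ζ), ?_⟩
    simp only [layeredNoise_succ]
    have h5 : Integrable (fun p : ℝ × (Fin n → ℝ) => ζ * (n * p.2 i - ∑ j, p.2 j)) (ρ.prod κ) :=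
      (h3.sub h4).const_mul ζ
    rw [integral_add h1 h5, integral_const_mul, integral_sub h3 h4, integral_const_mul, integral_finsetSum _ fun j _ => h2 j]
    simp [h10, h20]

/-! ### The decoder and its pointwise error -/

/-- The scheme with layered noise and a decoder that recovers `c (AB - RS) + (c - c²)(A+R)(B+S)` up
to small terms. -/
noncomputable def layeredScheme (n : ℕ) (ξ ζ c : ℝ) (ρ : Measure ℝ) (κ : Measure (Fin n → ℝ))
    [IsProbabilityMeasure ρ] [IsProbabilityMeasure κ] : CodingScheme (n + 1) where
  lawR := (ρ.prod κ).map (layeredNoise n ξ ζ)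
  lawS := (ρ.prod κ).map (layeredNoise n ξ ζ)
  isProbR := Measure.isProbabilityMeasure_map (by fun_prop)
  isProbS := Measure.isProbabilityMeasure_map (by fun_prop)
  a := fun _ => 1
  b := fun _ => 1
  -- The terms in `c / ξ` form a difference quotient in the scale of the noise; the remaining `2 * c
  -- - c ^ 2` weights the average of the other nodes.
  w := Fin.cons (-(c / ξ)) fun _ => (2 * c - c ^ 2 + c / ξ) / n
  w₀ := 0

theorem add_sq_le_young {θ : ℝ} (hθ : 0 < θ) (a b : ℝ) :
    (a + b) ^ 2 ≤ (1 + θ) * a ^ 2 + (1 + θ⁻¹) * b ^ 2 := by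
  have h1 : 0 ≤ θ⁻¹ * (θ * a - b) ^ 2 := by positivity
  have h2 : θ⁻¹ * (θ * a - b) ^ 2 = θ * a ^ 2 - 2 * a * b + θ⁻¹ * b ^ 2 := by
    field_simp
    ring
  linarith

section error

variable {n : ℕ} {ξ ζ c : ℝ} {ρ : Measure ℝ} {κ : Measure (Fin n → ℝ)}
  [IsProbabilityMeasure ρ] [IsProbabilityMeasure κ]

/-- The main term factors because `AB - c (AB - RS) - (c - c²)(A + R)(B + S)` is the product of the
two linear estimation errors. -/
theorem layeredScheme_error (hn : n ≠ 0) (hξ : ξ ≠ 0) (A B : ℝ) (p q : ℝ × (Fin n → ℝ)) :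
    A * B - (layeredScheme n ξ ζ c ρ κ).estimate A B (layeredNoise n ξ ζ p)
        (layeredNoise n ξ ζ q) =
      ((1 - c) * A - c * p.1) * ((1 - c) * B - c * q.1) +
        (c * ξ * (p.1 * q.1) - (2 * c - c ^ 2 + c / ξ) * ζ ^ 2 / n *
          ∑ i, (n * p.2 i - ∑ j, p.2 j) * (n * q.2 i - ∑ j, q.2 j)) := by
  have hn' : (n : ℝ) ≠ 0 := Nat.cast_ne_zero.2 hn
  -- This cancellation removes the terms of first order in `ζ`, which division by `ξ` would make
  -- large.
  have hz : ∀ v : Fin n → ℝ, ∑ i, (n * v i - ∑ j, v j) = 0 := by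
    intro v
    simp [Finset.sum_sub_distrib, ← Finset.mul_sum]
  have hsum : ∑ i : Fin n, (1 * A + (p.1 + ζ * (n * p.2 i - ∑ j, p.2 j))) *
      (1 * B + (q.1 + ζ * (n * q.2 i - ∑ j, q.2 j))) =
      n * ((A + p.1) * (B + q.1)) +
        ζ ^ 2 * ∑ i, (n * p.2 i - ∑ j, p.2 j) * (n * q.2 i - ∑ j, q.2 j) := by
    have : ∀ i : Fin n, (1 * A + (p.1 + ζ * (n * p.2 i - ∑ j, p.2 j))) *
      (1 * B + (q.1 + ζ * (n * q.2 i - ∑ j, q.2 j))) =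
        (A + p.1) * (B + q.1) + (A + p.1) * ζ * (n * q.2 i - ∑ j, q.2 j) +
          (B + q.1) * ζ * (n * p.2 i - ∑ j, p.2 j) +
          ζ ^ 2 * ((n * p.2 i - ∑ j, p.2 j) * (n * q.2 i - ∑ j, q.2 j)) := fun i => by ring
    rw [Finset.sum_congr rfl fun i _ => this i]
    simp only [Finset.sum_add_distrib, ← Finset.mul_sum, hz]
    simp
    ring
  simp only [CodingScheme.estimate, CodingScheme.nodeOutput, layeredScheme, Fin.sum_univ_succ,
    Fin.cons_zero, Fin.cons_succ, layeredNoise_zero, layeredNoise_succ, ← Finset.mul_sum, hsum]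
  generalize ∑ i, (n * p.2 i - ∑ j, p.2 j) * (n * q.2 i - ∑ j, q.2 j) = Q
  field_simp
  ring

theorem abs_natCast_mul_sub_sum_le (v : Fin n → ℝ) (i : Fin n) :
    |n * v i - ∑ j, v j| ≤ 2 * n * ‖v‖ := by
  have h1 : |∑ j, v j| ≤ n * ‖v‖ := by
    refine (Finset.abs_sum_le_sum_abs _ _).trans ?_
    refine (Finset.sum_le_sum fun j _ => norm_le_pi_norm v j).trans ?_
    simp
  have h2 : |n * v i| ≤ n * ‖v‖ := by
    rw [abs_mul, Nat.abs_cast]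
    exact mul_le_mul_of_nonneg_left (norm_le_pi_norm v i) (Nat.cast_nonneg n)
  linarith [abs_sub (n * v i) (∑ j, v j)]

/-- Young's inequality separates the main term from the residue; every summand is then a function of
`(A, p)` times one of `(B, q)`, ready for independence. -/
theorem layeredScheme_error_sq_le (hn : n ≠ 0) {x θ : ℝ} (hx0 : 0 < x) (hx1 : x ≤ 1)
    (hc0 : 0 ≤ c) (hc1 : c ≤ 1) (hθ : 0 < θ) (A B : ℝ) (p q : ℝ × (Fin n → ℝ)) :
    |A * B - (layeredScheme n (x ^ 3) (x ^ 2) c ρ κ).estimate A B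
        (layeredNoise n (x ^ 3) (x ^ 2) p) (layeredNoise n (x ^ 3) (x ^ 2) q)| ^ 2 ≤
      (1 + θ) * (((1 - c) * A - c * p.1) ^ 2 * ((1 - c) * B - c * q.1) ^ 2) +
        2 * (1 + θ⁻¹) * x ^ 2 * (p.1 ^ 2 * q.1 ^ 2) +
        2 * (1 + θ⁻¹) * x ^ 2 * (12 * n ^ 2) ^ 2 * (‖p.2‖ ^ 2 * ‖q.2‖ ^ 2) := by
  rw [sq_abs, layeredScheme_error hn (by positivity)]
  have hn' : (0 : ℝ) < n := Nat.cast_pos.2 (Nat.pos_of_ne_zero hn)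
  set X := ((1 - c) * A - c * p.1) with hX
  set Y := ((1 - c) * B - c * q.1) with hY
  set Q := ∑ i, (n * p.2 i - ∑ j, p.2 j) * (n * q.2 i - ∑ j, q.2 j) with hQ
  have hQle : |Q| ≤ n * (4 * n ^ 2 * (‖p.2‖ * ‖q.2‖)) := by
    rw [hQ]
    refine (Finset.abs_sum_le_sum_abs _ _).trans ?_
    have h1 : ∀ i ∈ (Finset.univ : Finset (Fin n)),
        |(n * p.2 i - ∑ j, p.2 j) * (n * q.2 i - ∑ j, q.2 j)| ≤
          4 * n ^ 2 * (‖p.2‖ * ‖q.2‖) := by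
      intro i _
      rw [abs_mul]
      refine (mul_le_mul (abs_natCast_mul_sub_sum_le p.2 i) (abs_natCast_mul_sub_sum_le q.2 i)
        (abs_nonneg _) (by positivity)).trans (le_of_eq (by ring))
    refine (Finset.sum_le_sum h1).trans ?_
    simp
  -- The critical term is `c ζ² / ξ = c x`; this is why the exponents are 3 and 2.
  have hk : (2 * c - c ^ 2 + c / x ^ 3) * (x ^ 2) ^ 2 ≤ 3 * x := by
    have h1 : (2 * c - c ^ 2 + c / x ^ 3) * (x ^ 2) ^ 2 = (2 * c - c ^ 2) * x ^ 4 + c * x := by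
      field_simp
    have h2 : x ^ 4 ≤ x := by
      calc x ^ 4 ≤ x ^ 1 := pow_le_pow_of_le_one hx0.le hx1 (by norm_num)
        _ = x := pow_one x
    have h3 : 0 ≤ x ^ 4 := by positivity
    rw [h1]
    nlinarith
  have hk0 : 0 ≤ (2 * c - c ^ 2 + c / x ^ 3) * (x ^ 2) ^ 2 := by
    have : 0 ≤ 2 * c - c ^ 2 := by nlinarith
    positivity
  set k := (2 * c - c ^ 2 + c / x ^ 3) * (x ^ 2) ^ 2 with hkdef
  have hb2 : (k / n * Q) ^ 2 ≤ x ^ 2 * (12 * n ^ 2) ^ 2 * (‖p.2‖ ^ 2 * ‖q.2‖ ^ 2) := by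
    have h1 : |k / n * Q| ≤ x * (12 * n ^ 2) * (‖p.2‖ * ‖q.2‖) := by
      rw [abs_mul, abs_of_nonneg (by positivity)]
      calc k / n * |Q| ≤ (3 * x) / n * (n * (4 * n ^ 2 * (‖p.2‖ * ‖q.2‖))) := by gcongr
        _ = _ := by field_simp; ring
    rw [← sq_abs]
    calc |k / n * Q| ^ 2 ≤ (x * (12 * n ^ 2) * (‖p.2‖ * ‖q.2‖)) ^ 2 := by gcongr
      _ = _ := by ring
  have hb1 : (c * x ^ 3 * (p.1 * q.1)) ^ 2 ≤ x ^ 2 * (p.1 ^ 2 * q.1 ^ 2) := by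
    have h1 : (c * x ^ 2) ^ 2 ≤ 1 := by
      have : c * x ^ 2 ≤ 1 := mul_le_one₀ hc1 (by positivity) (pow_le_one₀ hx0.le hx1)
      exact pow_le_one₀ (by positivity) this
    calc (c * x ^ 3 * (p.1 * q.1)) ^ 2 = (c * x ^ 2) ^ 2 * (x ^ 2 * (p.1 ^ 2 * q.1 ^ 2)) := by ring
      _ ≤ 1 * (x ^ 2 * (p.1 ^ 2 * q.1 ^ 2)) := by gcongr
      _ = _ := one_mul _
  generalize c * x ^ 3 * (p.1 * q.1) = b₁ at *
  generalize k / n * Q = b₂ at *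
  have hyoung : (X * Y + (b₁ - b₂)) ^ 2 ≤
      (1 + θ) * (X * Y) ^ 2 + (1 + θ⁻¹) * (b₁ - b₂) ^ 2 := add_sq_le_young hθ _ _
  have h3 : (b₁ - b₂) ^ 2 ≤ 2 * (b₁ ^ 2 + b₂ ^ 2) := by nlinarith [sq_nonneg (b₁ + b₂)]
  have h4 : (1 + θ⁻¹) * (b₁ - b₂) ^ 2 ≤ (1 + θ⁻¹) * (2 * (x ^ 2 * (p.1 ^ 2 * q.1 ^ 2) +
      x ^ 2 * (12 * n ^ 2) ^ 2 * (‖p.2‖ ^ 2 * ‖q.2‖ ^ 2))) := by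
    gcongr
    linarith
  calc _ ≤ _ := hyoung
    _ ≤ _ := add_le_add_right h4 _
    _ = _ := by ring

end error

/-! ### The mean square error -/

/-- For fixed inputs the product measure on the noises splits the integral into a function of `A`
times a function of `B`; independence of the inputs splits it again. -/
theorem lintegral_mul_of_indepFun {Ω₁ Ω₂ : Type*} [MeasurableSpace Ω₁] [MeasurableSpace Ω₂]
    {P : Measure (ℝ × ℝ)} (hP : IndepFun Prod.fst Prod.snd P) {μ : Measure Ω₁} {ν : Measure Ω₂}
    [SFinite P] [SFinite μ] [SFinite ν] {f : ℝ × Ω₁ → ENNReal} {g : ℝ × Ω₂ → ENNReal}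
    (hf : Measurable f) (hg : Measurable g) :
    ∫⁻ ω : (ℝ × ℝ) × (Ω₁ × Ω₂), f (ω.1.1, ω.2.1) * g (ω.1.2, ω.2.2) ∂(P.prod (μ.prod ν)) =
      (∫⁻ z, ∫⁻ p, f (z.1, p) ∂μ ∂P) * ∫⁻ z, ∫⁻ q, g (z.2, q) ∂ν ∂P := by
  rw [lintegral_prod _ (by fun_prop)]
  have h1 : ∀ z : ℝ × ℝ, ∫⁻ y : Ω₁ × Ω₂, f (z.1, y.1) * g (z.2, y.2) ∂(μ.prod ν) =
      (∫⁻ p, f (z.1, p) ∂μ) * ∫⁻ q, g (z.2, q) ∂ν := fun z =>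
    lintegral_prod_mul (f := fun p => f (z.1, p)) (g := fun q => g (z.2, q)) (by fun_prop)
      (by fun_prop)
  simp only [h1]
  have hF : Measurable fun a : ℝ => ∫⁻ p, f (a, p) ∂μ := hf.lintegral_prod_right'
  have hG : Measurable fun a : ℝ => ∫⁻ q, g (a, q) ∂ν := hg.lintegral_prod_right'
  exact lintegral_mul_eq_lintegral_mul_lintegral_of_indepFun (hF.comp measurable_fst)
    (hG.comp measurable_snd) (hP.comp hF hG)

variable {n : ℕ} {c η s M : ℝ} {ρ : Measure ℝ} {κ : Measure (Fin n → ℝ)}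
  [IsProbabilityMeasure ρ] [IsProbabilityMeasure κ]

/-- The cross term vanishes for each fixed input because the noise is centred, so the input itself
need not be. -/
theorem lintegral_sq_sub_le {P : Measure (ℝ × ℝ)} [IsProbabilityMeasure P] (hρ : MemLp id 2 ρ)
    (hρ0 : ∫ x, x ∂ρ = 0) (hs : ∫ x, x ^ 2 ∂ρ = s) {f : ℝ × ℝ → ℝ} (hf : MemLp f 2 P)
    (hfη : ∫ z, f z ^ 2 ∂P ≤ η) (c : ℝ) :
    ∫⁻ z, ∫⁻ p : ℝ × (Fin n → ℝ), ENNReal.ofReal (((1 - c) * f z - c * p.1) ^ 2)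
      ∂(ρ.prod κ) ∂P ≤ ENNReal.ofReal ((1 - c) ^ 2 * η + c ^ 2 * s) := by
  have hs0 : 0 ≤ s := hs ▸ integral_nonneg fun x => sq_nonneg x
  have h1 : Integrable (fun p : ℝ × (Fin n → ℝ) => p.1) (ρ.prod κ) :=
    (hρ.integrable (by norm_num)).comp_fst κ
  have h2 : Integrable (fun p : ℝ × (Fin n → ℝ) => p.1 ^ 2) (ρ.prod κ) :=
    hρ.integrable_sq.comp_fst κ
  have h10 : ∫ p : ℝ × (Fin n → ℝ), p.1 ∂(ρ.prod κ) = 0 := by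
    rw [integral_fun_fst (fun x : ℝ => x), hρ0, smul_zero]
  have h20 : ∫ p : ℝ × (Fin n → ℝ), p.1 ^ 2 ∂(ρ.prod κ) = s := by
    rw [integral_fun_fst (fun x : ℝ => x ^ 2), hs]
    simp
  have hin : ∀ a : ℝ, ∫⁻ p : ℝ × (Fin n → ℝ), ENNReal.ofReal (((1 - c) * a - c * p.1) ^ 2)
      ∂(ρ.prod κ) = ENNReal.ofReal ((1 - c) ^ 2 * a ^ 2 + c ^ 2 * s) := by
    intro a
    have e : (fun p : ℝ × (Fin n → ℝ) => ((1 - c) * a - c * p.1) ^ 2) =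
        fun p => ((1 - c) ^ 2 * a ^ 2 - 2 * (1 - c) * a * c * p.1) + c ^ 2 * p.1 ^ 2 := by
      funext p; ring
    have i1 : Integrable (fun p : ℝ × (Fin n → ℝ) =>
        (1 - c) ^ 2 * a ^ 2 - 2 * (1 - c) * a * c * p.1) (ρ.prod κ) :=
      (integrable_const _).sub (h1.const_mul _)
    have hi : Integrable (fun p : ℝ × (Fin n → ℝ) => ((1 - c) * a - c * p.1) ^ 2)
        (ρ.prod κ) := by
      rw [e]
      exact i1.add (h2.const_mul _)
    rw [← ofReal_integral_eq_lintegral_ofReal hi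
      (Filter.Eventually.of_forall fun p => sq_nonneg _), e, integral_add i1 (h2.const_mul _),
      integral_sub (integrable_const _) (h1.const_mul _), integral_const_mul (2 * (1 - c) * a * c),
      integral_const_mul (c ^ 2), h10, h20]
    simp
  simp only [hin]
  have hi : Integrable (fun z => (1 - c) ^ 2 * f z ^ 2 + c ^ 2 * s) P :=
    (hf.integrable_sq.const_mul _).add (integrable_const _)
  rw [← ofReal_integral_eq_lintegral_ofReal hi
    (Filter.Eventually.of_forall fun z => by simp only [Pi.zero_apply]; positivity),
    integral_add (hf.integrable_sq.const_mul _) (integrable_const _), integral_const_mul]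
  refine ENNReal.ofReal_le_ofReal ?_
  simp only [integral_const, probReal_univ, one_smul]
  gcongr

theorem lintegral_fst_sq (hρ : MemLp id 2 ρ) (hs : ∫ x, x ^ 2 ∂ρ = s) :
    ∫⁻ p : ℝ × (Fin n → ℝ), ENNReal.ofReal (p.1 ^ 2) ∂(ρ.prod κ) = ENNReal.ofReal s := by
  have h : Integrable (fun p : ℝ × (Fin n → ℝ) => p.1 ^ 2) (ρ.prod κ) :=
    hρ.integrable_sq.comp_fst κ
  rw [← ofReal_integral_eq_lintegral_ofReal h (Filter.Eventually.of_forall fun p => sq_nonneg _),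
    integral_fun_fst (fun x : ℝ => x ^ 2)]
  simp [← hs]

theorem lintegral_norm_snd_sq (hκ : MemLp id 2 κ) (hM : ∫ x, ‖x‖ ^ 2 ∂κ = M) :
    ∫⁻ p : ℝ × (Fin n → ℝ), ENNReal.ofReal (‖p.2‖ ^ 2) ∂(ρ.prod κ) = ENNReal.ofReal M := by
  have h : Integrable (fun p : ℝ × (Fin n → ℝ) => ‖p.2‖ ^ 2) (ρ.prod κ) :=
    hκ.norm.integrable_sq.comp_snd ρ
  rw [← ofReal_integral_eq_lintegral_ofReal h (Filter.Eventually.of_forall fun p => sq_nonneg _),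
    integral_fun_snd (fun x : Fin n → ℝ => ‖x‖ ^ 2)]
  simp [← hM]

theorem layeredScheme_LMSE_le (hn : n ≠ 0) {x θ : ℝ} (hx0 : 0 < x) (hx1 : x ≤ 1)
    (hc0 : 0 ≤ c) (hc1 : c ≤ 1) (hθ : 0 < θ) (hη : 0 ≤ η) (hρ : MemLp id 2 ρ)
    (hρ0 : ∫ x, x ∂ρ = 0) (hs : ∫ x, x ^ 2 ∂ρ = s) (hκ : MemLp id 2 κ)
    (hM : ∫ x, ‖x‖ ^ 2 ∂κ = M) {P : Measure (ℝ × ℝ)} (hP : IsInputLaw η P) :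
    (layeredScheme n (x ^ 3) (x ^ 2) c ρ κ).LMSE P ≤
      ENNReal.ofReal ((1 + θ) * ((1 - c) ^ 2 * η + c ^ 2 * s) ^ 2 +
        2 * (1 + θ⁻¹) * x ^ 2 * (s ^ 2 + (12 * n ^ 2) ^ 2 * M ^ 2)) := by
  have := hP.isProb
  have hs0 : 0 ≤ s := hs ▸ integral_nonneg fun x => sq_nonneg x
  have hM0 : 0 ≤ M := hM ▸ integral_nonneg fun x => sq_nonneg _
  set C := layeredScheme n (x ^ 3) (x ^ 2) c ρ κ with hC
  set τ := ρ.prod κ with hτ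
  set N := layeredNoise n (x ^ 3) (x ^ 2) with hN
  have hNm : Measurable N := measurable_layeredNoise _ _ _
  have hmap : P.prod (C.lawR.prod C.lawS) =
      (P.prod (τ.prod τ)).map (Prod.map id (Prod.map N N)) := by
    rw [← Measure.map_prod_map _ _ measurable_id (by fun_prop),
      ← Measure.map_prod_map _ _ hNm hNm, Measure.map_id]
    rfl
  have hest : Measurable fun ω : (ℝ × ℝ) × ((Fin (n + 1) → ℝ) × (Fin (n + 1) → ℝ)) =>
      ENNReal.ofReal (|ω.1.1 * ω.1.2 - C.estimate ω.1.1 ω.1.2 ω.2.1 ω.2.2| ^ 2) := by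
    simp only [CodingScheme.estimate, CodingScheme.nodeOutput]
    fun_prop
  rw [CodingScheme.LMSE, hmap, lintegral_map hest (by fun_prop)]
  set f₁ : ℝ × (ℝ × (Fin n → ℝ)) → ENNReal :=
    fun z => ENNReal.ofReal (((1 - c) * z.1 - c * z.2.1) ^ 2) with hf₁
  set f₂ : ℝ × (ℝ × (Fin n → ℝ)) → ENNReal := fun z => ENNReal.ofReal (z.2.1 ^ 2) with hf₂
  set f₃ : ℝ × (ℝ × (Fin n → ℝ)) → ENNReal := fun z => ENNReal.ofReal (‖z.2.2‖ ^ 2) with hf₃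
  have m₁ : Measurable f₁ := by fun_prop
  have m₂ : Measurable f₂ := by fun_prop
  have m₃ : Measurable f₃ := by fun_prop
  set k := 2 * (1 + θ⁻¹) * x ^ 2 with hk
  have hk0 : 0 ≤ k := by positivity
  calc _ ≤ ∫⁻ ω : (ℝ × ℝ) × ((ℝ × (Fin n → ℝ)) × (ℝ × (Fin n → ℝ))),
        (ENNReal.ofReal (1 + θ) * (f₁ (ω.1.1, ω.2.1) * f₁ (ω.1.2, ω.2.2)) +
          ENNReal.ofReal k * (f₂ (ω.1.1, ω.2.1) * f₂ (ω.1.2, ω.2.2)) +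
          ENNReal.ofReal (k * (12 * n ^ 2) ^ 2) * (f₃ (ω.1.1, ω.2.1) * f₃ (ω.1.2, ω.2.2)))
        ∂(P.prod (τ.prod τ)) := by
        refine lintegral_mono fun ω => ?_
        simp only [hf₁, hf₂, hf₃]
        rw [← ENNReal.ofReal_mul (by positivity), ← ENNReal.ofReal_mul (by positivity),
          ← ENNReal.ofReal_mul (by positivity), ← ENNReal.ofReal_mul (by positivity),
          ← ENNReal.ofReal_mul (by positivity), ← ENNReal.ofReal_mul (by positivity),
          ← ENNReal.ofReal_add (by positivity) (by positivity),
          ← ENNReal.ofReal_add (by positivity) (by positivity)]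
        exact ENNReal.ofReal_le_ofReal
          (layeredScheme_error_sq_le hn hx0 hx1 hc0 hc1 hθ ω.1.1 ω.1.2 ω.2.1 ω.2.2)
    _ = ENNReal.ofReal (1 + θ) * ((∫⁻ z, ∫⁻ p, f₁ (z.1, p) ∂τ ∂P) *
          ∫⁻ z, ∫⁻ p, f₁ (z.2, p) ∂τ ∂P) +
        ENNReal.ofReal k * ((∫⁻ z, ∫⁻ p, f₂ (z.1, p) ∂τ ∂P) * ∫⁻ z, ∫⁻ p, f₂ (z.2, p) ∂τ ∂P) +
        ENNReal.ofReal (k * (12 * n ^ 2) ^ 2) * ((∫⁻ z, ∫⁻ p, f₃ (z.1, p) ∂τ ∂P) *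
          ∫⁻ z, ∫⁻ p, f₃ (z.2, p) ∂τ ∂P) := by
        rw [lintegral_add_left (by fun_prop), lintegral_add_left (by fun_prop),
          lintegral_const_mul _ (by fun_prop), lintegral_const_mul _ (by fun_prop),
          lintegral_const_mul _ (by fun_prop), lintegral_mul_of_indepFun hP.indep m₁ m₁,
          lintegral_mul_of_indepFun hP.indep m₂ m₂, lintegral_mul_of_indepFun hP.indep m₃ m₃]
    _ ≤ ENNReal.ofReal (1 + θ) * (ENNReal.ofReal ((1 - c) ^ 2 * η + c ^ 2 * s) *
          ENNReal.ofReal ((1 - c) ^ 2 * η + c ^ 2 * s)) +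
        ENNReal.ofReal k * (ENNReal.ofReal s * ENNReal.ofReal s) +
        ENNReal.ofReal (k * (12 * n ^ 2) ^ 2) * (ENNReal.ofReal M * ENNReal.ofReal M) := by
        simp only [hf₁, hf₂, hf₃, hτ, lintegral_fst_sq hρ hs, lintegral_norm_snd_sq hκ hM,
          lintegral_const, measure_univ, mul_one]
        gcongr
        · exact lintegral_sq_sub_le hρ hρ0 hs hP.memLp_fst hP.fst_le c
        · exact lintegral_sq_sub_le hρ hρ0 hs hP.memLp_snd hP.snd_le c
    _ = _ := by
        rw [← ENNReal.ofReal_mul (by positivity), ← ENNReal.ofReal_mul (by positivity),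
          ← ENNReal.ofReal_mul (by positivity), ← ENNReal.ofReal_mul (by positivity),
          ← ENNReal.ofReal_mul (by positivity), ← ENNReal.ofReal_mul (by positivity),
          ← ENNReal.ofReal_add (by positivity) (by positivity),
          ← ENNReal.ofReal_add (by positivity) (by positivity)]
        congr 1
        ring

/-! ### Choice of the parameters -/

/-- The squared linear minimum mean square error depends continuously and monotonically on the
noise variance. -/
theorem exists_pos_lmmse_sq_lt {η s₀ δ : ℝ} (hη : 0 < η) (hs₀ : 0 ≤ s₀) (hδ : 0 < δ) :
    ∃ δ' > 0, ∀ s, 0 ≤ s → s < s₀ + δ' →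
      (η * s / (η + s)) ^ 2 < (η * s₀ / (η + s₀)) ^ 2 + δ := by
  have hcont : ContinuousAt (fun s : ℝ => (η * s / (η + s)) ^ 2) s₀ := by
    refine ContinuousAt.pow (ContinuousAt.div (by fun_prop) (by fun_prop) ?_) 2
    positivity
  obtain ⟨r, hr, h⟩ := Metric.continuousAt_iff.1 hcont δ hδ
  refine ⟨r / 2, by positivity, fun s hs hlt => ?_⟩
  have h1 := h (x := s₀ + r / 2) (by
    rw [Real.dist_eq, add_sub_cancel_left, abs_of_pos (by positivity)]; linarith)
  rw [Real.dist_eq] at h1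
  have h2 := (abs_lt.1 h1).2
  have h3 : η * s / (η + s) ≤ η * (s₀ + r / 2) / (η + (s₀ + r / 2)) := by
    rw [div_le_div_iff₀ (by positivity) (by positivity)]
    nlinarith [mul_pos hη hη]
  have h4 : (η * s / (η + s)) ^ 2 ≤ (η * (s₀ + r / 2) / (η + (s₀ + r / 2))) ^ 2 := by gcongr
  linarith

end DPMult

theorem corollary1 (N t : ℕ) (htN : t < N) (hN : N ≤ 2 * t)
    (η : ℝ) (hη : 0 < η) (ε δ : ℝ) (hε : 0 < ε) (hδ : 0 < δ) :
    ∃ C : DPMult.CodingScheme N, C.IsCentered ∧ C.IsNodeDP t ε ∧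
      ∀ P : MeasureTheory.Measure (ℝ × ℝ), DPMult.IsInputLaw η P →
        C.LMSE P ≤ ENNReal.ofReal
          (η ^ 2 * DPMult.sigmaStar ε ^ 4 / (η + DPMult.sigmaStar ε ^ 2) ^ 2 + δ) := by
  open DPMult in
  obtain ⟨n, rfl⟩ : ∃ n, N = n + 1 := ⟨N - 1, by omega⟩
  -- The hypotheses force `t ≥ 1`, so a node other than `0` exists.
  have hn : n ≠ 0 := by omega
  have hs₀ : 0 ≤ sigmaStar ε ^ 2 := sq_nonneg _
  -- The loss `δ` is split in three: excess noise variance, the factor `1 + θ`, and the residue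
  -- controlled by `x`.
  obtain ⟨δ', hδ', hφ⟩ := exists_pos_lmmse_sq_lt hη hs₀ (show 0 < δ / 3 by positivity)
  obtain ⟨ε', hε', ρ, hρp, hρDP, hρ2, hρ0, hρs⟩ := exists_noise_near_sigmaStar hε hδ'
  -- The second layer spends exactly the privacy `ε - ε'` left over by `ρ`; its variance may be
  -- huge, since `x` is chosen afterwards.
  obtain ⟨κ', hκ'p, hκ'DP, hκ'2, -⟩ :=
    exists_translationDP (E := Fin n → ℝ) (sub_pos.2 hε')
  obtain ⟨m, hκp, hκDP, hκ2, hκ0⟩ := exists_centered_translationDP hκ'DP hκ'2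
  set κ := κ'.map (fun x => x + m)
  obtain ⟨s, hs⟩ : ∃ s, ∫ x, x ^ 2 ∂ρ = s := ⟨_, rfl⟩
  obtain ⟨M, hM⟩ : ∃ M, ∫ x, ‖x‖ ^ 2 ∂κ = M := ⟨_, rfl⟩
  have hs0 : 0 ≤ s := hs ▸ integral_nonneg fun x => sq_nonneg x
  have hφs := hφ s hs0 (hs ▸ hρs)
  set φ := (η * s / (η + s)) ^ 2 with hφdef
  have hφ0 : 0 ≤ φ := sq_nonneg _
  set θ := δ / (3 * (φ + 1)) with hθdef
  have hθ : 0 < θ := by positivity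
  have hθφ : θ * φ ≤ δ / 3 := by
    rw [hθdef, div_mul_eq_mul_div, div_le_div_iff₀ (by positivity) (by norm_num)]
    nlinarith
  set K := 2 * (1 + θ⁻¹) * (s ^ 2 + (12 * n ^ 2) ^ 2 * M ^ 2) with hK
  have hK0 : 0 ≤ K := by positivity
  obtain ⟨x, hx0, hx1, hxK⟩ : ∃ x : ℝ, 0 < x ∧ x ≤ 1 ∧ x * K ≤ δ / 3 := by
    refine ⟨min 1 (δ / (3 * (K + 1))), by positivity, min_le_left _ _, ?_⟩
    calc min 1 (δ / (3 * (K + 1))) * K ≤ δ / (3 * (K + 1)) * K := by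
          gcongr
          exact min_le_right _ _
      _ ≤ δ / 3 := by
          rw [div_mul_eq_mul_div, div_le_div_iff₀ (by positivity) (by norm_num)]
          nlinarith
  have hx32 : x ^ 3 ≤ x ^ 2 := pow_le_pow_of_le_one hx0.le hx1 (by norm_num)
  -- This `c` minimises `(1 - c)² η + c² s`, with minimum `η s / (η + s)`.
  set c := η / (η + s) with hc
  have hc0 : 0 ≤ c := by positivity
  have hc1 : c ≤ 1 := by
    rw [hc, div_le_one (by positivity)]
    linarith
  have hcenter := integrable_layeredNoise (n := n) (x ^ 3) (x ^ 2)
    (hρ2.integrable (by norm_num)) (hκ2.integrable (by norm_num)) hρ0 hκ0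
  refine ⟨layeredScheme n (x ^ 3) (x ^ 2) c ρ κ, ⟨hcenter, hcenter, rfl⟩, ?_, ?_⟩
  · intro A₀ A₁ B₀ B₁ hA hB T hT S _
    have hε₂ : ε' + (ε - ε') = ε := by ring
    have hDP {a b : ℝ} (hab : |a - b| ≤ 1) := layeredNoise_map_le (pow_pos hx0 3) (pow_pos hx0 2)
      hx32 hρDP hκDP hab T (by omega) S
    rw [hε₂] at hDP
    exact ⟨hDP hA, hDP hB⟩
  · intro P hP
    refine (layeredScheme_LMSE_le hn hx0 hx1 hc0 hc1 hθ hη.le hρ2 hρ0 hs hκ2 hM hP).trans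
      (ENNReal.ofReal_le_ofReal ?_)
    have h1 : (1 - c) ^ 2 * η + c ^ 2 * s = η * s / (η + s) := by
      rw [hc]
      field_simp
      ring
    have h2 : η ^ 2 * sigmaStar ε ^ 4 / (η + sigmaStar ε ^ 2) ^ 2 =
        (η * sigmaStar ε ^ 2 / (η + sigmaStar ε ^ 2)) ^ 2 := by
      rw [div_pow]
      ring
    have h3 : 2 * (1 + θ⁻¹) * x ^ 2 * (s ^ 2 + (12 * n ^ 2) ^ 2 * M ^ 2) = x * (x * K) := by
      rw [hK]
      ring
    have h4 : x * (x * K) ≤ x * K := mul_le_of_le_one_left (by positivity) hx1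
    rw [h1, h2, h3, ← hφdef]
    linarith
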